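/- Let $G$ be a lattice ordered abelian group with identity $e$ and positive cone $P=\{g\in G: g\ge e\}$, and write $p\vee q$ for least upper bounds. Let $X=(X_p)_{p\in P}$ be a product system over $P$ with coefficients in a $\mathrm{C}^*$-algebra $A$: each $X_p$ is a non-degenerate $A$-correspondence, $X_e=A$, and there are associative products $X_p\times X_q\to X_{pq}$, $(x,y)\mapsto xy$, that induce unitary $A$-linear isomorphisms $X_p\otimes_A X_q\cong X_{pq}$, those with $e$ being the left and right actions of $A$. For adjointable $S$ on $X_p$ and $p\le r$ write $S\otimes I$ for the adjointable operator on $X_r$ with $(S\otimes I)(xy)=(Sx)y$ for $x\in X_p$, $y\in X_{p^{-1}r}$. $X$ is compactly aligned if $(S\otimes I)(T\otimes I)\in\mathcal K(X_{p\vee q})$ for all $p,q\in P$, $S\in\mathcal K(X_p)$, $T\in\mathcal K(X_q)$, where $\mathcal K(X_p)$ is the closed linear span of the operators $\theta_{x,y}\colon z\mapsto x\langle y,z\rangle$. A representation $\psi$ of $X$ in a $\mathrm{C}^*$-algebra $B$ is a family of linear maps $\psi_p\colon X_p\to B$ such that $\psi_e$ is a $*$-homomorphism, $\psi_p(x)\psi_q(y)=\psi_{pq}(xy)$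 and $\psi_p(x)^*\psi_p(y)=\psi_e(\langle x,y\rangle)$. It is faithful if $\psi_e$ is injective. For $B=B(H)$, $H$ a Hilbert space, $\psi$ is Nica-covariant if $Q_pQ_q=Q_{p\vee q}$ for all $p,q\in P$, where $Q_p$ is the orthogonal projection onto the closed linear span of $\psi_p(X_p)H$. If $X$ is compactly aligned, a representation in an arbitrary $\mathrm{C}^*$-algebra $B$ is Nica-covariant if $\psi_p(S)\psi_q(T)=\psi_{p\vee q}((S\otimes I)(T\otimes I))$ for all $p,q\in P$, $S\in\mathcal K(X_p)$, $T\in\mathcal K(X_q)$, where $\psi_p\colon\mathcal K(X_p)\to B$ is the continuous linear map with $\theta_{x,y}\mapsto\psi_p(x)\psi_p(y)^*$. Consider the following property of a representation $\psi$: for all $p,q\in P$, $x\in X_p$ and $y\in X_q$, $$\psi_p(x)^*\psi_q(y)\in\overline{\operatorname{span}}\{\psi_{p^{-1}(p\vee q)}(z)\,\psi_{q^{-1}(p\vee q)}(w)^* : z\in X_{p^{-1}(p\vee q)},\ w\in X_{q^{-1}(p\vee q)}\}\qquad(*)$$ (norm closure). (i) If some faithful Nica-covariant representation $\psi\colon X\to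 B(H)$ on a Hilbert space $H$ satisfies $(*)$, then $X$ is compactly aligned. (ii) Conversely, if $X$ is compactly aligned, then every Nica-covariant representation of $X$, on a Hilbert space or in an arbitrary $\mathrm{C}^*$-algebra (each in the sense above), satisfies $(*)$. -/

import Mathlib

universe uA uE uG uX uB uH uP

noncomputable section

open scoped TensorProduct

/-- A (right) Hilbert `A`-module: a complex Banach space `E` with a right action `x · a = rmul x a`
of the C⋆-algebra `A` and an `A`-valued inner product `ip x y`, linear in the second variable,
whose norm is `‖x‖ = ‖⟨x, x⟩‖ ^ (1/2)`. -/
class HilbertModule (A : Type uA) (E : Type uE) [NonUnitalCStarAlgebra A] [PartialOrder A]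
    [NormedAddCommGroup E] [NormedSpace ℂ E] where
  /-- the `A`-valued inner product -/
  ip : E → E →ₗ[ℂ] A
  /-- the right action of `A` -/
  rmul : E →ₗ[ℂ] A →ₗ[ℂ] E
  rmul_rmul : ∀ (x : E) (a b : A), rmul (rmul x a) b = rmul x (a * b)
  ip_rmul_right : ∀ (x y : E) (a : A), ip x (rmul y a) = ip x y * a
  ip_self_nonneg : ∀ x : E, 0 ≤ ip x x
  ip_self_eq_zero : ∀ x : E, ip x x = 0 ↔ x = 0
  star_ip : ∀ x y : E, star (ip y x) = ip x y
  norm_eq_sqrt : ∀ x : E, ‖x‖ = √‖ip x x‖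
  complete : CompleteSpace E

/-- An `A`-correspondence: a Hilbert `A`-module `E` with a non-degenerate ⋆-homomorphism `left`
(written `φ`) from `A` into the adjointable operators on `E`; that `φ` is a ⋆-homomorphism into the
adjointable operators says that `φ a` has the adjoint `φ (star a)`. -/
class CStarCorrespondence (A : Type uA) (E : Type uE) [NonUnitalCStarAlgebra A] [PartialOrder A]
    [NormedAddCommGroup E] [NormedSpace ℂ E] extends HilbertModule A E where
  /-- the left action `φ` of `A` -/
  left : A →ₙₐ[ℂ] (E →L[ℂ] E)
  ip_left : ∀ (a : A) (x y : E), ip (left a x) y = ip x (left (star a) y)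
  left_nondegenerate :
    (Submodule.span ℂ {z : E | ∃ (a : A) (x : E), z = left a x}).topologicalClosure = ⊤

namespace HilbertModule

variable (A : Type uA) {E : Type uE} [NonUnitalCStarAlgebra A] [PartialOrder A]
  [NormedAddCommGroup E] [NormedSpace ℂ E] [HilbertModule A E]

theorem ip_add_left (x y z : E) : ip (A := A) (x + y) z = ip x z + ip y z := by
  rw [← star_ip, map_add, star_add, star_ip, star_ip]

theorem ip_smul_left (c : ℂ) (x z : E) : ip (A := A) (c • x) z = star c • ip x z := by
  rw [← star_ip, map_smul, star_smul, star_ip]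

theorem ip_zero_left (z : E) : ip (A := A) 0 z = 0 := by
  rw [← star_ip, map_zero, star_zero]

theorem ip_rmul_left (x y : E) (a : A) : ip (A := A) (rmul x a) y = star a * ip x y := by
  rw [← star_ip, ip_rmul_right, star_mul, star_ip]

/-- Mathlib's `CStarModule B E` has `⟨x, b • y⟩ = b * ⟨x, y⟩`, so that a right Hilbert `A`-module
in the sense used here is a `CStarModule Aᵐᵒᵖ E`. -/
@[reducible] def toCStarModule :
    letI : SMul Aᵐᵒᵖ E := ⟨fun a x => rmul x a.unop⟩
    CStarModule Aᵐᵒᵖ E :=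
  letI : SMul Aᵐᵒᵖ E := ⟨fun a x => rmul x a.unop⟩
  { inner := fun x y => MulOpposite.op (ip x y)
    inner_add_right := by intros; simp
    inner_self_nonneg := fun {x} => ip_self_nonneg (A := A) x
    inner_self := by
      intro x
      rw [MulOpposite.op_eq_zero_iff]
      exact ip_self_eq_zero x
    inner_op_smul_right := by
      intro a x y
      apply MulOpposite.unop_injective
      exact ip_rmul_right x y a.unop
    inner_smul_right_complex := by intros; simp
    star_inner := by
      intro x y
      rw [← MulOpposite.op_star, star_ip]
    norm_eq_sqrt_norm_inner_self := fun x => norm_eq_sqrt (A := A) x }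

theorem norm_ip_le [StarOrderedRing A] (x y : E) : ‖ip (A := A) x y‖ ≤ ‖x‖ * ‖y‖ := by
  let _ : SMul Aᵐᵒᵖ E := ⟨fun a x => rmul x a.unop⟩
  let _ : CStarModule Aᵐᵒᵖ E := toCStarModule A
  exact CStarModule.norm_inner_le (A := Aᵐᵒᵖ) E (x := x) (y := y)

theorem continuous_ip [StarOrderedRing A] : Continuous fun z : E × E => ip (A := A) z.1 z.2 := by
  let _ : SMul Aᵐᵒᵖ E := ⟨fun a x => rmul x a.unop⟩
  let _ : CStarModule Aᵐᵒᵖ E := toCStarModule A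
  exact MulOpposite.continuous_unop.comp (CStarModule.continuous_inner (A := Aᵐᵒᵖ) (E := E))

theorem norm_sq_eq (x : E) : ‖x‖ ^ 2 = ‖ip (A := A) x x‖ := by
  rw [norm_eq_sqrt (A := A), Real.sq_sqrt (norm_nonneg _)]

theorem norm_rmul_le (x : E) (a : A) : ‖rmul x a‖ ≤ ‖x‖ * ‖a‖ := by
  refine le_of_sq_le_sq ?_ (by positivity)
  rw [norm_sq_eq A, ip_rmul_right, ip_rmul_left, mul_pow, norm_sq_eq A x]
  calc ‖star a * ip x x * a‖ ≤ ‖star a‖ * ‖ip (A := A) x x‖ * ‖a‖ := norm_mul₃_le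
    _ = ‖ip (A := A) x x‖ * ‖a‖ ^ 2 := by rw [norm_star]; ring

/-- `T` has an adjoint. -/
def IsAdjointable (T : E →L[ℂ] E) : Prop :=
  ∃ T' : E →L[ℂ] E, ∀ x y : E, ip (A := A) (T x) y = ip x (T' y)

variable (E) in
/-- The algebra `𝓛(E)` of adjointable operators, with the operator norm. -/
def adjointable : Subalgebra ℂ (E →L[ℂ] E) where
  carrier := {T | IsAdjointable A T}
  mul_mem' := by
    rintro S T ⟨S', hS⟩ ⟨T', hT⟩
    exact ⟨T' * S', fun x y => by simp [hS, hT]⟩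
  add_mem' := by
    rintro S T ⟨S', hS⟩ ⟨T', hT⟩
    exact ⟨S' + T', fun x y => by simp [hS, hT, ip_add_left]⟩
  algebraMap_mem' := by
    intro c
    refine ⟨algebraMap ℂ _ (star c), fun x y => ?_⟩
    simp [Algebra.algebraMap_eq_smul_one, ip_smul_left]

variable [StarOrderedRing A]

/-- The operator `θ_{x,y} z = x · ⟨y, z⟩`. -/
def theta (x y : E) : adjointable A E :=
  have bound : ∀ u v z : E, ‖rmul u (ip (A := A) v z)‖ ≤ ‖u‖ * ‖v‖ * ‖z‖ := fun u v z =>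
    (norm_rmul_le A u _).trans (by
      rw [mul_assoc]
      exact mul_le_mul_of_nonneg_left (norm_ip_le A v z) (norm_nonneg u))
  ⟨LinearMap.mkContinuous (rmul x ∘ₗ ip (A := A) y) (‖x‖ * ‖y‖) (bound x y),
    LinearMap.mkContinuous (rmul y ∘ₗ ip (A := A) x) (‖y‖ * ‖x‖) (bound y x), fun u v => by
      simp [ip_rmul_left, ip_rmul_right, star_ip]⟩

theorem theta_apply (x y z : E) : (theta A x y : E →L[ℂ] E) z = rmul x (ip (A := A) y z) := rfl

variable (E) in
/-- The generalized compact operators `𝓚(E)`: the closed linear span of the `θ_{x,y}` in `𝓛(E)`. -/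
def compacts : Submodule ℂ (adjointable A E) :=
  (Submodule.span ℂ {T | ∃ x y : E, T = theta A x y}).topologicalClosure

theorem theta_mem_compacts (x y : E) : theta A x y ∈ compacts A E :=
  Submodule.le_topologicalClosure _ (Submodule.subset_span ⟨x, y, rfl⟩)

end HilbertModule

open HilbertModule CStarCorrespondence

/-- A product system over the monoid `P` with coefficients in `A`, on the family `X` of
`A`-correspondences. The product `x y` of `x ∈ X p` and `y ∈ X q` is `mul rfl x y ∈ X (p * q)`; for
convenience `mul h` is its copy in `X r`, for any `h : p * q = r`.
That `x ⊗ y ↦ x y` is a unitary `A`-linear isomorphism of the interior tensor product `X p ⊗_A X q`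
(the Hausdorff completion of the algebraic one for `⟨x ⊗ y, x' ⊗ y'⟩ = ⟨y, ⟨x, x'⟩ · y'⟩`)
onto `X r` means that it is bilinear, `A`-balanced, `A`-linear, preserves inner products and has
dense linear span. -/
structure ProductSystem {P : Type uP} [Monoid P] (A : Type uA) [NonUnitalCStarAlgebra A]
    [PartialOrder A] (X : P → Type uX) [∀ p, NormedAddCommGroup (X p)]
    [∀ p, NormedSpace ℂ (X p)] [∀ p, CStarCorrespondence A (X p)] where
  /-- the identification of `A`, as the trivial correspondence, with `X 1` -/
  unit : A ≃ₗ[ℂ] X 1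
  unit_ip : ∀ a b : A, ip (unit a) (unit b) = star a * b
  unit_rmul : ∀ a b : A, rmul (unit a) b = unit (a * b)
  unit_left : ∀ a b : A, left a (unit b) = unit (a * b)
  /-- the product of the system -/
  mul : ∀ {p q r : P}, p * q = r → X p →ₗ[ℂ] X q →ₗ[ℂ] X r
  mul_balanced : ∀ {p q r : P} (h : p * q = r) (x : X p) (a : A) (y : X q),
    mul h (rmul x a) y = mul h x (left a y)
  mul_rmul : ∀ {p q r : P} (h : p * q = r) (x : X p) (y : X q) (a : A),
    mul h x (rmul y a) = rmul (mul h x y) a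
  ip_mul : ∀ {p q r : P} (h : p * q = r) (x x' : X p) (y y' : X q),
    ip (A := A) (mul h x y) (mul h x' y') = ip y (left (ip (A := A) x x') y')
  mul_dense : ∀ {p q r : P} (h : p * q = r),
    (Submodule.span ℂ {z : X r | ∃ (x : X p) (y : X q), z = mul h x y}).topologicalClosure = ⊤
  /-- multiplication by `X 1 = A` from the left is the left action -/
  unit_mul : ∀ (p : P) (a : A) (x : X p), mul (one_mul p) (unit a) x = left a x
  /-- multiplication by `X 1 = A` from the right is the right action -/
  mul_unit : ∀ (p : P) (x : X p) (a : A), mul (mul_one p) x (unit a) = rmul x a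
  mul_assoc : ∀ {p q r pq qr s : P} (h₁ : p * q = pq) (h₂ : pq * r = s) (h₃ : q * r = qr)
    (h₄ : p * qr = s) (x : X p) (y : X q) (z : X r),
    mul h₂ (mul h₁ x y) z = mul h₄ x (mul h₃ y z)

namespace ProductSystem

section general

variable {P : Type uP} [Monoid P] {A : Type uA} [NonUnitalCStarAlgebra A]
  [PartialOrder A] {X : P → Type uX} [∀ p, NormedAddCommGroup (X p)]
  [∀ p, NormedSpace ℂ (X p)] [∀ p, CStarCorrespondence A (X p)] (Φ : ProductSystem A X)

/-- The linear map `x ⊗ y ↦ x y` on the algebraic tensor product. -/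
def tmul {p q r : P} (h : p * q = r) : X p ⊗[ℂ] X q →ₗ[ℂ] X r := TensorProduct.lift (Φ.mul h)

theorem denseRange_tmul {p q r : P} (h : p * q = r) : DenseRange (Φ.tmul h) := by
  have hle : Submodule.span ℂ {z : X r | ∃ (x : X p) (y : X q), z = Φ.mul h x y} ≤
      LinearMap.range (Φ.tmul h) := by
    rw [Submodule.span_le]
    rintro _ ⟨x, y, rfl⟩
    exact ⟨x ⊗ₜ y, by simp [tmul]⟩
  have h1 := Submodule.topologicalClosure_mono hle
  rw [Φ.mul_dense h, top_le_iff] at h1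
  have h2 := (Submodule.dense_iff_topologicalClosure_eq_top).2 h1
  exact h2

theorem ip_tmul_rTensor {p q r : P} (h : p * q = r) (S S' : X p →L[ℂ] X p)
    (hS : ∀ x y : X p, ip (A := A) (S x) y = ip x (S' y)) (t t' : X p ⊗[ℂ] X q) :
    ip (A := A) (Φ.tmul h (LinearMap.rTensor (X q) (S : X p →ₗ[ℂ] X p) t)) (Φ.tmul h t') =
      ip (Φ.tmul h t) (Φ.tmul h (LinearMap.rTensor (X q) (S' : X p →ₗ[ℂ] X p) t')) := by
  induction t using TensorProduct.induction_on with
  | zero => simp [ip_zero_left]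
  | add a b ha hb => simp only [map_add, ip_add_left, ha, hb]
  | tmul x y =>
    induction t' using TensorProduct.induction_on with
    | zero => simp
    | add a b ha hb => simp only [map_add, ha, hb]
    | tmul x' y' => simp [tmul, Φ.ip_mul, hS]

theorem exists_bound_mul_left [StarOrderedRing A] {p q r : P} (h : p * q = r) (y : X q) :
    ∃ C : ℝ, 0 ≤ C ∧ ∀ x : X p, ‖Φ.mul h x y‖ ≤ C * ‖x‖ := by
  let f : A →ₗ[ℂ] A :=
    { toFun := fun a => ip y (left a y)
      map_add' := fun a b => by simp
      map_smul' := fun c a => by simp }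
  obtain ⟨C, hC⟩ := PositiveLinearMap.exists_norm_apply_le (PositiveLinearMap.mk₀ f (by
    intro a ha
    obtain ⟨c, rfl⟩ := CStarAlgebra.nonneg_iff_eq_star_mul_self.1 ha
    have e : f (star c * c) = ip (left c y) (left c y) := by
      simp [f, ip_left]
    rw [e]
    exact ip_self_nonneg _))
  refine ⟨√C, by positivity, fun x => ?_⟩
  refine le_of_sq_le_sq ?_ (by positivity)
  rw [norm_sq_eq A, Φ.ip_mul, mul_pow, Real.sq_sqrt (NNReal.coe_nonneg C),
    norm_sq_eq A x]
  exact hC _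

theorem exists_bound_rTensor [StarOrderedRing A] {p q r : P} (h : p * q = r) (S : X p →L[ℂ] X p)
    (hS : IsAdjointable A S) : ∃ C : ℝ, ∀ t : X p ⊗[ℂ] X q,
      ‖(Φ.tmul h ∘ₗ LinearMap.rTensor (X q) (S : X p →ₗ[ℂ] X p)) t‖ ≤ C * ‖Φ.tmul h t‖ := by
  obtain ⟨S', hS⟩ := hS
  have hS' : ∀ x y : X p, ip (A := A) (S' x) y = ip x (S y) := fun x y => by
    rw [← star_ip, ← hS, star_ip]
  set R : X p →L[ℂ] X p := S' * S with hR
  have hRn : ∀ (n : ℕ) (x y : X p), ip (A := A) ((R ^ n) x) y = ip x ((R ^ n) y) := by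
    intro n
    induction n with
    | zero => simp
    | succ n ih =>
      intro x y
      have e1 : (R ^ (n + 1)) x = (R ^ n) (R x) := by rw [pow_succ]; rfl
      have e2 : (R ^ (n + 1)) y = R ((R ^ n) y) := by rw [pow_succ']; rfl
      rw [e1, e2, ih, hR]
      simp [hS, hS']
  refine ⟨√(‖R‖ + 1), fun t => ?_⟩
  set u := Φ.tmul h with hu
  set a : ℕ → X r := fun n => u (LinearMap.rTensor (X q) ((R ^ n : X p →L[ℂ] X p) : X p →ₗ[ℂ] X p) t)
    with ha
  have ha0 : a 0 = u t := by
    have : ((R ^ 0 : X p →L[ℂ] X p) : X p →ₗ[ℂ] X p) = LinearMap.id := by ext; simp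
    simp only [ha, this, LinearMap.rTensor_id, LinearMap.id_coe, id_eq]
  -- the elementary bound on the powers
  have hgrow : ∃ C : ℝ, 0 ≤ C ∧ ∀ n, ‖a n‖ ≤ C * (‖R‖ + 1) ^ n := by
    have hmul : ∀ y : X q, ∃ C : ℝ, 0 ≤ C ∧ ∀ x : X p, ‖Φ.mul h x y‖ ≤ C * ‖x‖ :=
      Φ.exists_bound_mul_left h
    have hall : ∀ t' : X p ⊗[ℂ] X q, ∃ C : ℝ, 0 ≤ C ∧ ∀ n : ℕ,
        ‖u (LinearMap.rTensor (X q) ((R ^ n : X p →L[ℂ] X p) : X p →ₗ[ℂ] X p) t')‖ ≤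
          C * (‖R‖ + 1) ^ n := by
      intro t'
      induction t' using TensorProduct.induction_on with
      | zero => exact ⟨0, le_rfl, fun n => by simp⟩
      | add v w hv hw =>
        obtain ⟨C, hC, hv⟩ := hv
        obtain ⟨D, hD, hw⟩ := hw
        refine ⟨C + D, by positivity, fun n => ?_⟩
        rw [map_add, map_add, add_mul]
        exact (norm_add_le _ _).trans (add_le_add (hv n) (hw n))
      | tmul x y =>
        obtain ⟨C, hC, hy⟩ := hmul y
        refine ⟨C * ‖x‖, by positivity, fun n => ?_⟩
        have hpow : ‖(R ^ n) x‖ ≤ (‖R‖ + 1) ^ n * ‖x‖ := by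
          induction n with
          | zero => simp
          | succ n ih =>
            have e1 : (R ^ (n + 1)) x = R ((R ^ n) x) := by rw [pow_succ']; rfl
            rw [e1]
            calc ‖R ((R ^ n) x)‖ ≤ ‖R‖ * ‖(R ^ n) x‖ := R.le_opNorm _
              _ ≤ (‖R‖ + 1) * ((‖R‖ + 1) ^ n * ‖x‖) := by
                gcongr
                linarith
              _ = _ := by ring
        have e : u (LinearMap.rTensor (X q) ((R ^ n : X p →L[ℂ] X p) : X p →ₗ[ℂ] X p) (x ⊗ₜ y)) =
            Φ.mul h ((R ^ n) x) y := rfl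
        rw [e]
        calc ‖Φ.mul h ((R ^ n) x) y‖ ≤ C * ‖(R ^ n) x‖ := hy _
          _ ≤ C * ((‖R‖ + 1) ^ n * ‖x‖) := by gcongr
          _ = _ := by ring
    exact hall t
  have hstep : ∀ n, ‖a n‖ ^ 2 ≤ ‖a 0‖ * ‖a (n + n)‖ := by
    intro n
    rw [norm_sq_eq A]
    have : ip (A := A) (a n) (a n) = ip (a 0) (a (n + n)) := by
      have h1 := Φ.ip_tmul_rTensor h (R ^ n) (R ^ n) (hRn n) t
        (LinearMap.rTensor (X q) ((R ^ n : X p →L[ℂ] X p) : X p →ₗ[ℂ] X p) t)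
      rw [ha0]
      refine h1.trans ?_
      rw [← LinearMap.comp_apply (LinearMap.rTensor (X q) _), ← LinearMap.rTensor_comp]
      simp only [ha, pow_add]
      rfl
    rw [this]
    exact norm_ip_le A _ _
  have hkey : ‖a 1‖ ≤ (‖R‖ + 1) * ‖a 0‖ := by
    rcases (norm_nonneg (a 0)).eq_or_lt with h0 | h0
    · have := hstep 1
      rw [← h0, zero_mul] at this
      have h1 : ‖a 1‖ = 0 := by
        apply pow_eq_zero_iff (two_ne_zero) |>.1
        exact le_antisymm this (by positivity)
      rw [h1, ← h0, mul_zero]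
    · have hpow : ∀ k : ℕ, ‖a 1‖ ^ (2 ^ k) * ‖a 0‖ ≤ ‖a 0‖ ^ (2 ^ k) * ‖a (2 ^ k)‖ := by
        intro k
        induction k with
        | zero => simp [mul_comm]
        | succ k ih =>
          have h2 := pow_le_pow_left₀ (by positivity) ih 2
          have h3 := hstep (2 ^ k)
          have e : 2 ^ (k + 1) = 2 ^ k + 2 ^ k := by ring
          rw [e, pow_add, pow_add]
          refine le_of_mul_le_mul_right ?_ h0
          calc _ = (‖a 1‖ ^ (2 ^ k) * ‖a 0‖) ^ 2 := by ring
            _ ≤ _ := h2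
            _ = (‖a 0‖ ^ (2 ^ k)) ^ 2 * ‖a (2 ^ k)‖ ^ 2 := by ring
            _ ≤ (‖a 0‖ ^ (2 ^ k)) ^ 2 * (‖a 0‖ * ‖a (2 ^ k + 2 ^ k)‖) := by gcongr
            _ = _ := by ring
      obtain ⟨C, hC, hgrow⟩ := hgrow
      by_contra! hlt
      have hpos : 0 < (‖R‖ + 1) * ‖a 0‖ := by positivity
      have hc : 1 < ‖a 1‖ / ((‖R‖ + 1) * ‖a 0‖) := (one_lt_div hpos).2 hlt
      obtain ⟨k, hk⟩ := pow_unbounded_of_one_lt (C / ‖a 0‖) hc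
      have hk' := hk.trans_le (pow_le_pow_right₀ hc.le (Nat.lt_two_pow_self (n := k)).le)
      rw [div_pow, div_lt_div_iff₀ h0 (by positivity)] at hk'
      have h4 := (hpow k).trans (mul_le_mul_of_nonneg_left (hgrow (2 ^ k)) (by positivity))
      rw [mul_pow] at hk'
      nlinarith
  have hfin : ‖u (LinearMap.rTensor (X q) (S : X p →ₗ[ℂ] X p) t)‖ ^ 2 ≤ ‖a 0‖ * ‖a 1‖ := by
    rw [norm_sq_eq A]
    have : ip (A := A) (u (LinearMap.rTensor (X q) (S : X p →ₗ[ℂ] X p) t))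
        (u (LinearMap.rTensor (X q) (S : X p →ₗ[ℂ] X p) t)) = ip (a 0) (a 1) := by
      rw [ha0]
      refine (Φ.ip_tmul_rTensor h S S' hS t _).trans ?_
      rw [← LinearMap.comp_apply (LinearMap.rTensor (X q) _), ← LinearMap.rTensor_comp]
      simp only [ha, pow_one]
      rfl
    rw [this]
    exact norm_ip_le A _ _
  rw [ha0] at hkey hfin
  refine le_of_sq_le_sq ?_ (by positivity)
  rw [mul_pow, Real.sq_sqrt (by positivity)]
  refine hfin.trans ?_
  calc ‖u t‖ * ‖a 1‖ ≤ ‖u t‖ * ((‖R‖ + 1) * ‖u t‖) := by gcongr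
    _ = (‖R‖ + 1) * ‖u t‖ ^ 2 := by ring

/-- The homomorphism `ι : 𝓛(X p) → 𝓛(X r)`, `r = p * q`, that sends `S` to `S ⊗ I`, that is, to the
operator with `(S ⊗ I) (x y) = (S x) y`; it is obtained by extending `x ⊗ y ↦ (S x) y` from the
algebraic tensor product, see `iota_apply_mul`. -/
def iota [StarOrderedRing A] {p q r : P} (h : p * q = r) (S : adjointable A (X p)) :
    adjointable A (X r) :=
  have : CompleteSpace (X r) := HilbertModule.complete A
  ⟨LinearMap.extendOfNorm
      (Φ.tmul h ∘ₗ LinearMap.rTensor (X q) ((S : X p →L[ℂ] X p) : X p →ₗ[ℂ] X p)) (Φ.tmul h), by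
    obtain ⟨S, S', hS⟩ := S
    have hS' : ∀ x y : X p, ip (A := A) (S' x) y = ip x (S y) := fun x y => by
      rw [← star_ip, ← hS, star_ip]
    refine ⟨LinearMap.extendOfNorm
      (Φ.tmul h ∘ₗ LinearMap.rTensor (X q) (S' : X p →ₗ[ℂ] X p)) (Φ.tmul h), fun z w => ?_⟩
    refine (Φ.denseRange_tmul h).induction_on₂ (p := fun z w => ip (A := A)
      (LinearMap.extendOfNorm (Φ.tmul h ∘ₗ LinearMap.rTensor (X q) (S : X p →ₗ[ℂ] X p))
        (Φ.tmul h) z) w = ip z (LinearMap.extendOfNorm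
          (Φ.tmul h ∘ₗ LinearMap.rTensor (X q) (S' : X p →ₗ[ℂ] X p)) (Φ.tmul h) w)) ?_ ?_ z w
    · exact isClosed_eq
        ((continuous_ip A).comp
          (((ContinuousLinearMap.continuous _).comp continuous_fst).prodMk continuous_snd))
        ((continuous_ip A).comp
          (continuous_fst.prodMk ((ContinuousLinearMap.continuous _).comp continuous_snd)))
    · intro t t'
      rw [LinearMap.extendOfNorm_eq (Φ.denseRange_tmul h) (Φ.exists_bound_rTensor h S ⟨S', hS⟩),
        LinearMap.extendOfNorm_eq (Φ.denseRange_tmul h) (Φ.exists_bound_rTensor h S' ⟨S, hS'⟩)]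
      exact Φ.ip_tmul_rTensor h S S' hS t t'⟩

theorem iota_apply_mul [StarOrderedRing A] {p q r : P} (h : p * q = r) (S : adjointable A (X p))
    (x : X p) (y : X q) :
    (Φ.iota h S : X r →L[ℂ] X r) (Φ.mul h x y) = Φ.mul h ((S : X p →L[ℂ] X p) x) y := by
  have : CompleteSpace (X r) := HilbertModule.complete A
  exact LinearMap.extendOfNorm_eq (Φ.denseRange_tmul h)
    (Φ.exists_bound_rTensor h (S : X p →L[ℂ] X p) S.2) (x ⊗ₜ[ℂ] y)

/-- An (isometric) representation `ψ` of a product system in a C⋆-algebra `B`. -/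
structure Representation (B : Type uB) [NonUnitalCStarAlgebra B] where
  /-- the linear maps `ψ_p : X p → B` -/
  toMap : ∀ p : P, X p →ₗ[ℂ] B
  /-- `ψ_e` as a ⋆-homomorphism on `A = X 1` -/
  coeff : A →⋆ₙₐ[ℂ] B
  toMap_unit : ∀ a : A, toMap 1 (Φ.unit a) = coeff a
  toMap_mul : ∀ {p q r : P} (h : p * q = r) (x : X p) (y : X q),
    toMap p x * toMap q y = toMap r (Φ.mul h x y)
  star_toMap_mul : ∀ (p : P) (x y : X p), star (toMap p x) * toMap p y = coeff (ip x y)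

variable {Φ}

/-- `ψ` is faithful: `ψ_e` is injective (then so is every `ψ_p`). -/
def Representation.Faithful {B : Type uB} [NonUnitalCStarAlgebra B]
    (ψ : Φ.Representation B) : Prop := Function.Injective ψ.coeff

/-- For a representation on a Hilbert space, the closed subspace `[ψ_p(X p) H]`. -/
def Representation.rangeSpace {H : Type uH} [NormedAddCommGroup H] [InnerProductSpace ℂ H]
    [CompleteSpace H] (ψ : Φ.Representation (H →L[ℂ] H)) (p : P) : Submodule ℂ H :=
  (Submodule.span ℂ {v : H | ∃ (x : X p) (ξ : H), v = ψ.toMap p x ξ}).topologicalClosure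

/-- `ρ_p(I)`: the value at `I` of the strict-strong extension of the representation
`θ_{x,y} ↦ ψ_p(x) ψ_p(y)^*` of `𝓚(X p)` on `H`, that is, the orthogonal projection onto
`[ψ_p(X p) H]`. -/
def Representation.rangeProj {H : Type uH} [NormedAddCommGroup H] [InnerProductSpace ℂ H]
    [CompleteSpace H] (ψ : Φ.Representation (H →L[ℂ] H)) (p : P) : H →L[ℂ] H :=
  haveI : CompleteSpace (ψ.rangeSpace p) :=
    (Submodule.isClosed_topologicalClosure _).completeSpace_coe
  (ψ.rangeSpace p).starProjection

end general

section lattice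

/-! For a lattice ordered abelian group `G`, the semigroup is the positive cone
`P = Submonoid.oneLE G = {g | 1 ≤ g}`. -/

variable {G : Type uG} [CommGroup G] [Lattice G] [IsOrderedMonoid G]

/-- The least upper bound `p ∨ q` of two elements of the positive cone. -/
def join (p q : Submonoid.oneLE G) : Submonoid.oneLE G :=
  ⟨(p : G) ⊔ q, le_sup_of_le_left p.2⟩

/-- `p⁻¹ (p ∨ q)`, an element of the positive cone. -/
def gapLeft (p q : Submonoid.oneLE G) : Submonoid.oneLE G :=
  ⟨(p : G)⁻¹ * ((p : G) ⊔ q), le_inv_mul_iff_le.2 le_sup_left⟩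

/-- `q⁻¹ (p ∨ q)`, an element of the positive cone. -/
def gapRight (p q : Submonoid.oneLE G) : Submonoid.oneLE G :=
  ⟨(q : G)⁻¹ * ((p : G) ⊔ q), le_inv_mul_iff_le.2 le_sup_right⟩

theorem mul_gapLeft (p q : Submonoid.oneLE G) : p * gapLeft p q = join p q :=
  Subtype.ext (mul_inv_cancel_left _ _)

theorem mul_gapRight (p q : Submonoid.oneLE G) : q * gapRight p q = join p q :=
  Subtype.ext (mul_inv_cancel_left _ _)

variable {A : Type uA} [NonUnitalCStarAlgebra A] [PartialOrder A] [StarOrderedRing A]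
  {X : Submonoid.oneLE G → Type uX} [∀ p, NormedAddCommGroup (X p)]
  [∀ p, NormedSpace ℂ (X p)] [∀ p, CStarCorrespondence A (X p)] (Φ : ProductSystem A X)

/-- `(S ⊗ I)(T ⊗ I) ∈ 𝓛(X (p ∨ q))` for `S ∈ 𝓛(X p)` and `T ∈ 𝓛(X q)`. -/
def joinMul {p q : Submonoid.oneLE G} (S : adjointable A (X p)) (T : adjointable A (X q)) :
    adjointable A (X (join p q)) :=
  Φ.iota (mul_gapLeft p q) S * Φ.iota (mul_gapRight p q) T

/-- Compact alignment: `(S ⊗ I)(T ⊗ I) ∈ 𝓚(X (p ∨ q))` for `S ∈ 𝓚(X p)` and `T ∈ 𝓚(X q)`. -/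
def CompactlyAligned : Prop :=
  ∀ (p q : Submonoid.oneLE G), ∀ S ∈ compacts A (X p), ∀ T ∈ compacts A (X q),
    Φ.joinMul S T ∈ compacts A (X (join p q))

variable {Φ}

/-- Nica covariance of a representation on a Hilbert space:
`ρ_p(I) ρ_q(I) = ρ_{p ∨ q}(I)` for all `p`, `q`. -/
def Representation.NicaCovariant {H : Type uH} [NormedAddCommGroup H] [InnerProductSpace ℂ H]
    [CompleteSpace H] (ψ : Φ.Representation (H →L[ℂ] H)) : Prop :=
  ∀ p q : Submonoid.oneLE G, ψ.rangeProj p * ψ.rangeProj q = ψ.rangeProj (join p q)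

/-- Nica covariance of a representation of a compactly aligned product system in a C⋆-algebra:
`ψ_p(S) ψ_q(T) = ψ_{p ∨ q}((S ⊗ I)(T ⊗ I))` for all `S ∈ 𝓚(X p)` and `T ∈ 𝓚(X q)`, where on `𝓚(X p)`
one denotes by `ψ_p` the continuous linear map with `θ_{x,y} ↦ ψ_p(x) ψ_p(y)^*` (`K p` below). -/
def Representation.NicaCovariantAbstract (hΦ : Φ.CompactlyAligned)
    {B : Type uB} [NonUnitalCStarAlgebra B] (ψ : Φ.Representation B) : Prop :=
  ∃ K : ∀ p, compacts A (X p) →L[ℂ] B,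
    (∀ (p) (x y : X p),
      K p ⟨theta A x y, theta_mem_compacts A x y⟩ = ψ.toMap p x * star (ψ.toMap p y)) ∧
    ∀ (p q : Submonoid.oneLE G) (S : compacts A (X p)) (T : compacts A (X q)),
      K p S * K q T =
        K (join p q) ⟨Φ.joinMul (S : adjointable A (X p)) (T : adjointable A (X q)),
          hΦ p q S S.2 T T.2⟩

/-- For all `p`, `q`, `x ∈ X p`, `y ∈ X q`, the element `ψ_p(x)^* ψ_q(y)` lies in the norm closed
linear span of the `ψ(z) ψ(w)^*` with `z ∈ X (p⁻¹ (p ∨ q))` and `w ∈ X (q⁻¹ (p ∨ q))`. -/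
def Representation.SpanProperty {B : Type uB} [NonUnitalCStarAlgebra B]
    (ψ : Φ.Representation B) : Prop :=
  ∀ (p q : Submonoid.oneLE G) (x : X p) (y : X q),
    star (ψ.toMap p x) * ψ.toMap q y ∈
      (Submodule.span ℂ {b : B | ∃ (z : X (gapLeft p q)) (w : X (gapRight p q)),
        b = ψ.toMap _ z * star (ψ.toMap _ w)}).topologicalClosure

end lattice

end ProductSystem

end

/-!
Write `r = p ∨ q`, and let `ψ_p` also denote the continuous map `θ_{x,y} ↦ ψ_p(x) ψ_p(y)^*` on
`𝓚(X p)`. Its image lies in the closed span of the `ψ_p(x) ψ_p(y)^*`, and the element `b = ψ_p(S)`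
implements `S`, in the sense that `b ψ_p(x) = ψ_p(S x)`; then `b` implements `S ⊗ I` on `X r` as
well (`mul_toMap_iota`). Such an element exists for all `S ∈ 𝓚(X p)`
(`exists_mem_closure_mulStarSpan`), because `‖b‖ ≤ ‖S‖` (`norm_le_of_mul_toMap_eq`): on the span of
the `ψ_p(x) ψ_p(y)^*` the powers of `b b^*` grow at most like those of `S S^*`, and the norm of a
self-adjoint element is determined by the growth of its powers.

*From the span property to compact alignment.* For `S ∈ 𝓚(X p)` and `T ∈ 𝓚(X q)`, the span property
puts `ψ_p(S) ψ_q(T)` into the closed span of the `ψ_r(z) ψ_r(w)^*`, with `z, w ∈ X r`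
(`SpanProperty.mul_mem`). This element implements `(S ⊗ I)(T ⊗ I)`, and `ψ_r` is isometric if `ψ` is
faithful, so that approximating it by finite sums of `ψ_r(z) ψ_r(w)^*` approximates
`(S ⊗ I)(T ⊗ I)` in norm by sums of `θ_{z,w}` (`Faithful.mem_compacts`).

*From compact alignment to the span property.* By functional calculus each `x` is a limit of vectors
`θ_{u,v} x`, so that `ψ_p(x)^* ψ_q(y)` is a limit of elements `ψ_p(x)^* ψ_p(S) ψ_q(T) ψ_q(y)`, with
`S` and `T` of rank one. If `ψ_p(S) ψ_q(T)` is in the closed span of the `ψ_r(z) ψ_r(w)^*`, one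
approximates `z` by sums of `x' z'` and `w` by sums of `y' w'`, and
`ψ_p(x)^* ψ_r(x' z') = ψ(⟨x, x'⟩ z')` gives the claim (`spanProperty_of_mem_closure`). In a
`C⋆`-algebra, covariance says that `ψ_p(S) ψ_q(T) = ψ_r((S ⊗ I)(T ⊗ I))`, which is in that closed
span. On a Hilbert space both sides of this equation implement `(S ⊗ I)(T ⊗ I)`, so they agree on
`[ψ_r(X r) H]`; on the orthogonal complement both vanish, the left side since
`ψ_p(S) ψ_q(T) = ψ_p(S) Q_p Q_q ψ_q(T) = ψ_p(S) Q_r ψ_q(T) = ψ_p(S) ψ_q(T) Q_r`, where `Q_p` is the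
projection onto `[ψ_p(X p) H]`.
-/

section

open HilbertModule CStarCorrespondence

/-! ### Hilbert modules -/

namespace HilbertModule

section adjoint

variable {A : Type uA} {E : Type uE} [NonUnitalCStarAlgebra A] [PartialOrder A]
  [NormedAddCommGroup E] [NormedSpace ℂ E] [HilbertModule A E]

theorem ip_sub_left (x y z : E) : ip (A := A) (x - y) z = ip x z - ip y z := by
  rw [← star_ip, map_sub, star_sub, star_ip, star_ip]

/-- An adjoint has at most the norm of the operator (hence the same norm, by symmetry). -/
theorem norm_adjoint_le [StarOrderedRing A] {S S' : E →L[ℂ] E}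
    (h : ∀ x y : E, ip (A := A) (S x) y = ip x (S' y)) : ‖S'‖ ≤ ‖S‖ := by
  refine S'.opNorm_le_bound (norm_nonneg _) fun x => ?_
  rcases (norm_nonneg (S' x)).eq_or_lt with h0 | h0
  · rw [← h0]
    positivity
  refine le_of_mul_le_mul_right ?_ h0
  calc ‖S' x‖ * ‖S' x‖ = ‖ip (A := A) (S (S' x)) x‖ := by
        rw [← sq, norm_sq_eq A, h]
    _ ≤ ‖S (S' x)‖ * ‖x‖ := norm_ip_le A _ _
    _ ≤ ‖S‖ * ‖S' x‖ * ‖x‖ := by gcongr; exact S.le_opNorm _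
    _ = ‖S‖ * ‖x‖ * ‖S' x‖ := by ring

end adjoint

variable {A : Type uA} {E : Type uE} [NonUnitalCStarAlgebra A] [PartialOrder A]
  [StarOrderedRing A] [NormedAddCommGroup E] [NormedSpace ℂ E] [HilbertModule A E]

/-- Every vector is a norm limit of vectors `θ_{u,x} x = u · ⟨x, x⟩`. -/
theorem exists_norm_sub_rmul_ip_self_lt (x : E) {η : ℝ} (hη : 0 < η) :
    ∃ u : E, ‖x - rmul u (ip (A := A) x x)‖ < η := by
  set a : A := ip x x with ha_def
  have ha : 0 ≤ a := ip_self_nonneg x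
  have hsa : IsSelfAdjoint a := ha.isSelfAdjoint
  set δ : ℝ := η ^ 2 / 2 with hδ_def
  have hδ : 0 < δ := by positivity
  have hpos : ∀ t : ℝ, 0 < t ^ 2 + δ ^ 2 := fun t => by positivity
  -- `x - x · d` has square norm `‖a (1 - d)²‖`, for `d = f(a) a` and `f(t) t ≈ 1` away from `0`
  let f : ℝ → ℝ := fun t => t / (t ^ 2 + δ ^ 2)
  have hf : Continuous f := continuous_id.div (by fun_prop) fun t => (hpos t).ne'
  have hf0 : f 0 = 0 := by simp [f]
  set d : A := cfcₙ f a * a with hd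
  have hid : cfcₙ (fun t : ℝ => t) a = a := cfcₙ_id' ℝ a
  have hd' : cfcₙ (fun t : ℝ => f t * t) a = d := by
    rw [cfcₙ_mul f (fun t : ℝ => t) a hf.continuousOn hf0 continuousOn_id rfl, hid]
  have hg : Continuous fun t : ℝ => f t * t := hf.mul continuous_id
  have hdsa : star d = d := by
    rw [← hd']
    exact (cfcₙ_predicate (fun t : ℝ => f t * t) a : IsSelfAdjoint _)
  refine ⟨rmul x (cfcₙ f a), ?_⟩
  rw [rmul_rmul, ← hd]
  have hip : ip (A := A) (x - rmul x d) (x - rmul x d) = (a - a * d) - (d * a - d * a * d) := by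
    simp only [ip_sub_left, map_sub, ip_rmul_left, ip_rmul_right, hdsa, ← ha_def, sub_mul]
    abel
  have hcfc : cfcₙ (fun t : ℝ => (t - t * (f t * t)) - ((f t * t) * t - (f t * t) * t * (f t * t))) a
      = (a - a * d) - (d * a - d * a * d) := by
    have h1 : cfcₙ (fun t : ℝ => t * (f t * t)) a = a * d := by
      rw [cfcₙ_mul (fun t : ℝ => t) (fun t => f t * t) a continuousOn_id rfl hg.continuousOn
        (by simp), hid, hd']
    have h2 : cfcₙ (fun t : ℝ => (f t * t) * t) a = d * a := by
      rw [cfcₙ_mul (fun t => f t * t) (fun t : ℝ => t) a hg.continuousOn (by simp)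
        continuousOn_id rfl, hid, hd']
    have h3 : cfcₙ (fun t : ℝ => (f t * t) * t * (f t * t)) a = d * a * d := by
      rw [cfcₙ_mul (fun t => f t * t * t) (fun t => f t * t) a
        (hg.mul continuous_id).continuousOn (by simp) hg.continuousOn (by simp), h2, hd']
    rw [cfcₙ_sub (fun t : ℝ => t - t * (f t * t)) (fun t => (f t * t) * t - (f t * t) * t * (f t * t))
      a (continuous_id.sub (continuous_id.mul hg)).continuousOn (by simp)
      ((hg.mul continuous_id).sub ((hg.mul continuous_id).mul hg)).continuousOn (by simp),
      cfcₙ_sub (fun t : ℝ => t) (fun t => t * (f t * t)) a continuousOn_id rfl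
        (continuous_id.mul hg).continuousOn (by simp),
      cfcₙ_sub (fun t : ℝ => (f t * t) * t) (fun t => (f t * t) * t * (f t * t)) a
        (hg.mul continuous_id).continuousOn (by simp)
        ((hg.mul continuous_id).mul hg).continuousOn (by simp), h1, h2, h3, hid]
  have hle : ‖x - rmul x d‖ ^ 2 ≤ δ := by
    rw [norm_sq_eq A, hip, ← hcfc]
    refine norm_cfcₙ_le fun t ht => ?_
    have ht0 : 0 ≤ t := quasispectrum_nonneg_of_nonneg a ha t ht
    have e : (t - t * (f t * t)) - ((f t * t) * t - (f t * t) * t * (f t * t)) =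
        t * δ ^ 4 / (t ^ 2 + δ ^ 2) ^ 2 := by
      have := (hpos t).ne'
      simp only [f]
      field_simp
      ring
    rw [e, Real.norm_of_nonneg (by positivity), div_le_iff₀ (by positivity)]
    nlinarith [mul_nonneg hδ.le (mul_nonneg (sq_nonneg δ) (sq_nonneg (t - δ))),
      mul_nonneg hδ.le (sq_nonneg (t ^ 2)), mul_nonneg hδ.le (mul_nonneg (sq_nonneg δ) (sq_nonneg t)),
      mul_nonneg hδ.le (mul_nonneg (sq_nonneg δ) (sq_nonneg δ))]
  refine lt_of_pow_lt_pow_left₀ 2 hη.le (hle.trans_lt ?_)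
  rw [hδ_def]
  linarith [pow_pos hη 2]

theorem mem_closure_theta_apply (x : E) :
    x ∈ closure {z : E | ∃ u v : E, z = rmul u (ip (A := A) v x)} := by
  rw [Metric.mem_closure_iff]
  intro η hη
  obtain ⟨u, hu⟩ := exists_norm_sub_rmul_ip_self_lt (A := A) x hη
  exact ⟨_, ⟨u, x, rfl⟩, by rwa [dist_eq_norm]⟩

end HilbertModule

/-! ### Representations of product systems -/

namespace ProductSystem.Representation

section general

variable {P : Type uP} [Monoid P] {A : Type uA} [NonUnitalCStarAlgebra A]
  [PartialOrder A] {X : P → Type uX} [∀ p, NormedAddCommGroup (X p)]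
  [∀ p, NormedSpace ℂ (X p)] [∀ p, CStarCorrespondence A (X p)] {Φ : ProductSystem A X}

section nonunital

variable {B : Type uB} [NonUnitalCStarAlgebra B] (ψ : Φ.Representation B)

theorem coeff_mul_toMap (p : P) (a : A) (x : X p) :
    ψ.coeff a * ψ.toMap p x = ψ.toMap p (left a x) := by
  rw [← ψ.toMap_unit, ψ.toMap_mul (one_mul p), Φ.unit_mul]

theorem toMap_mul_coeff (p : P) (x : X p) (a : A) :
    ψ.toMap p x * ψ.coeff a = ψ.toMap p (rmul x a) := by
  rw [← ψ.toMap_unit, ψ.toMap_mul (mul_one p), Φ.mul_unit]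

theorem toMap_mul_star_mul (p : P) (x y z : X p) :
    ψ.toMap p x * star (ψ.toMap p y) * ψ.toMap p z = ψ.toMap p (rmul x (ip (A := A) y z)) := by
  rw [_root_.mul_assoc, ψ.star_toMap_mul, ψ.toMap_mul_coeff]

theorem star_toMap_mul_toMap_mul {p q r : P} (h : p * q = r) (x x' : X p) (y : X q) :
    star (ψ.toMap p x) * ψ.toMap r (Φ.mul h x' y) =
      ψ.toMap q (left (ip (A := A) x x') y) := by
  rw [← ψ.toMap_mul h, ← _root_.mul_assoc, ψ.star_toMap_mul, ψ.coeff_mul_toMap]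

theorem norm_toMap_le (p : P) (x : X p) : ‖ψ.toMap p x‖ ≤ ‖x‖ := by
  refine le_of_sq_le_sq ?_ (norm_nonneg _)
  rw [sq, ← CStarRing.norm_star_mul_self, ψ.star_toMap_mul, norm_sq_eq A]
  exact NonUnitalStarAlgHom.norm_apply_le ψ.coeff _

theorem continuous_toMap (p : P) : Continuous (ψ.toMap p) :=
  ((ψ.toMap p).mkContinuous 1 fun x => by simpa using ψ.norm_toMap_le p x).continuous

variable {ψ} in
theorem Faithful.norm_toMap (hψ : ψ.Faithful) (p : P) (x : X p) : ‖ψ.toMap p x‖ = ‖x‖ := by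
  refine (sq_eq_sq₀ (norm_nonneg _) (norm_nonneg _)).1 ?_
  rw [sq, ← CStarRing.norm_star_mul_self, ψ.star_toMap_mul, norm_sq_eq A]
  exact NonUnitalStarAlgHom.norm_map ψ.coeff hψ _

/-- The linear span of the products `ψ_p(x) ψ_q(y)^*`. -/
def mulStarSpan (p q : P) : Submodule ℂ B :=
  Submodule.span ℂ {b : B | ∃ (x : X p) (y : X q), b = ψ.toMap p x * star (ψ.toMap q y)}

theorem toMap_mul_star_mem (p q : P) (x : X p) (y : X q) :
    ψ.toMap p x * star (ψ.toMap q y) ∈ ψ.mulStarSpan p q :=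
  Submodule.subset_span ⟨x, y, rfl⟩

theorem mem_closure_of_mem_mulStarSpan {p q : P} {V : Submodule ℂ B} (f : B →L[ℂ] B)
    (h : ∀ (x : X p) (y : X q), f (ψ.toMap p x * star (ψ.toMap q y)) ∈ V.topologicalClosure)
    {b : B} (hb : b ∈ (ψ.mulStarSpan p q).topologicalClosure) : f b ∈ V.topologicalClosure := by
  have hle : ψ.mulStarSpan p q ≤ V.topologicalClosure.comap (f : B →ₗ[ℂ] B) := by
    refine Submodule.span_le.2 ?_
    rintro _ ⟨x, y, rfl⟩
    exact h x y
  exact Submodule.topologicalClosure_minimal _ hle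
    (V.isClosed_topologicalClosure.preimage f.continuous) hb

/-- If left multiplication by `b` implements `S` on `X p`, then it implements `S ⊗ I` on
`X (p * q)`. -/
theorem mul_toMap_iota [StarOrderedRing A] {p q r : P} (h : p * q = r) (S : adjointable A (X p))
    {b : B} (hb : ∀ x : X p, b * ψ.toMap p x = ψ.toMap p ((S : X p →L[ℂ] X p) x)) (z : X r) :
    b * ψ.toMap r z = ψ.toMap r ((Φ.iota h S : X r →L[ℂ] X r) z) := by
  refine (Φ.denseRange_tmul h).induction_on z ?_ fun t => ?_
  · exact isClosed_eq (continuous_const.mul (ψ.continuous_toMap r))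
      ((ψ.continuous_toMap r).comp (ContinuousLinearMap.continuous _))
  · induction t using TensorProduct.induction_on with
    | zero => simp
    | add s t hs ht => simp only [map_add, mul_add, hs, ht]
    | tmul x y =>
      change b * ψ.toMap r (Φ.mul h x y) = ψ.toMap r ((Φ.iota h S : X r →L[ℂ] X r) (Φ.mul h x y))
      rw [Φ.iota_apply_mul, ← ψ.toMap_mul h, ← ψ.toMap_mul h, ← _root_.mul_assoc, hb]

end nonunital

/-- The `C⋆`-identity gives `‖a‖ ^ 2 ^ k = ‖a ^ 2 ^ k‖` for self-adjoint `a`, so that the growth of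
the powers of `a` determines its norm. -/
theorem norm_le_of_norm_pow_mul_le {B : Type uB} [CStarAlgebra B] {a : B} (ha : IsSelfAdjoint a)
    {C r : ℝ} (hC : 0 ≤ C) (hr : 0 ≤ r) (h : ∀ n : ℕ, ‖a ^ n * a‖ ≤ C * r ^ n) : ‖a‖ ≤ r := by
  by_contra! hlt
  have hs : 0 < ‖a‖ := hr.trans_lt hlt
  obtain ⟨k, hk⟩ := exists_pow_lt_of_lt_one (show 0 < ‖a‖ / (C + 1) by positivity)
    ((div_lt_one hs).2 hlt)
  obtain ⟨n, hn⟩ : ∃ n, 2 ^ k = n + 1 := ⟨2 ^ k - 1, by have := Nat.one_le_two_pow (n := k); omega⟩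
  have hkn : k ≤ n := by have := Nat.lt_two_pow_self (n := k); omega
  have h1 : ‖a‖ ^ (n + 1) ≤ C * r ^ n := by
    have h2 : ‖a ^ (n + 1)‖ = ‖a‖ ^ (n + 1) := by
      rw [← hn]
      exact congrArg NNReal.toReal (ha.nnnorm_pow_two_pow k)
    rw [← h2, pow_succ]
    exact h n
  have h3 : (r / ‖a‖) ^ n < ‖a‖ / (C + 1) :=
    (pow_le_pow_of_le_one (by positivity) ((div_lt_one hs).2 hlt).le hkn).trans_lt hk
  rw [div_pow, div_lt_div_iff₀ (by positivity) (by positivity), ← pow_succ'] at h3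
  nlinarith [pow_nonneg hr n]

/-! ### Compact operators in a representation -/

section unital

variable {B : Type uB} [CStarAlgebra B] (ψ : Φ.Representation B)

/-- If left multiplication by `b` implements `S` on `X p` and `b` is in the span of the
`ψ_p(x) ψ_p(y)^*`, then `star b` implements the adjoint of `S`. -/
theorem star_mul_toMap {p : P} {b : B} (hb : b ∈ ψ.mulStarSpan p p) {S S' : X p →L[ℂ] X p}
    (hS : ∀ x y : X p, ip (A := A) (S x) y = ip x (S' y))
    (h : ∀ x : X p, b * ψ.toMap p x = ψ.toMap p (S x)) (x : X p) :
    star b * ψ.toMap p x = ψ.toMap p (S' x) := by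
  obtain ⟨z, hz⟩ : ∃ z : X p, star b * ψ.toMap p x = ψ.toMap p z := by
    refine Submodule.span_induction (p := fun b _ => ∃ z : X p, star b * ψ.toMap p x = ψ.toMap p z)
      ?_ ⟨0, by simp⟩ ?_ ?_ hb
    · rintro _ ⟨u, v, rfl⟩
      refine ⟨rmul v (ip (A := A) u x), ?_⟩
      rw [star_mul, star_star, ψ.toMap_mul_star_mul]
    · rintro b c - - ⟨z, hz⟩ ⟨w, hw⟩
      exact ⟨z + w, by rw [star_add, add_mul, hz, hw, map_add]⟩
    · rintro t b - ⟨z, hz⟩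
      exact ⟨star t • z, by rw [star_smul, smul_mul_assoc, hz, map_smul]⟩
  -- the difference of the two sides is `ψ_p(z - S' x)`, which is orthogonal to all of `ψ_p(X p)`
  have horth : ∀ y : X p, star (ψ.toMap p y) * ψ.toMap p (z - S' x) = 0 := fun y => by
    rw [map_sub, mul_sub, ← hz, ← _root_.mul_assoc, ← star_mul, h, ψ.star_toMap_mul,
      ψ.star_toMap_mul, hS, sub_self]
  rw [hz, ← sub_eq_zero, ← map_sub, ← CStarRing.star_mul_self_eq_zero_iff]
  exact horth _

/-- The map `θ_{x,y} ↦ ψ_p(x) ψ_p(y)^*` is contractive on the span of the `θ_{x,y}`. -/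
theorem norm_le_of_mul_toMap_eq [StarOrderedRing A] {p : P} {b : B} (hb : b ∈ ψ.mulStarSpan p p)
    {S : X p →L[ℂ] X p} (hS : IsAdjointable A S)
    (h : ∀ x : X p, b * ψ.toMap p x = ψ.toMap p (S x)) : ‖b‖ ≤ ‖S‖ := by
  obtain ⟨S', hS⟩ := hS
  set R : X p →L[ℂ] X p := S * S' with hR
  have ha : ∀ (n : ℕ) (x : X p), (b * star b) ^ n * ψ.toMap p x = ψ.toMap p ((R ^ n) x) := by
    intro n
    induction n with
    | zero => simp
    | succ n ih =>
      intro x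
      rw [pow_succ, _root_.mul_assoc, _root_.mul_assoc, ψ.star_mul_toMap hb hS h, h, ih, pow_succ]
      rfl
  have hpow : ∀ (n : ℕ) (x : X p), ‖(R ^ n) x‖ ≤ ‖R‖ ^ n * ‖x‖ := by
    intro n
    induction n with
    | zero => simp
    | succ n ih =>
      intro x
      have e1 : (R ^ (n + 1)) x = R ((R ^ n) x) := by rw [pow_succ']; rfl
      rw [e1]
      calc ‖R ((R ^ n) x)‖ ≤ ‖R‖ * ‖(R ^ n) x‖ := R.le_opNorm _
        _ ≤ ‖R‖ * (‖R‖ ^ n * ‖x‖) := by gcongr; exact ih x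
        _ = _ := by ring
  obtain ⟨C, hC, hgrow⟩ : ∃ C : ℝ, 0 ≤ C ∧ ∀ n : ℕ, ‖(b * star b) ^ n * b‖ ≤ C * ‖R‖ ^ n := by
    refine Submodule.span_induction (p := fun c _ => ∃ C : ℝ, 0 ≤ C ∧
      ∀ n : ℕ, ‖(b * star b) ^ n * c‖ ≤ C * ‖R‖ ^ n) ?_ ⟨0, le_rfl, by simp⟩ ?_ ?_ hb
    · rintro _ ⟨x, y, rfl⟩
      refine ⟨‖x‖ * ‖star (ψ.toMap p y)‖, by positivity, fun n => ?_⟩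
      rw [← _root_.mul_assoc, ha]
      calc _ ≤ ‖ψ.toMap p ((R ^ n) x)‖ * ‖star (ψ.toMap p y)‖ := norm_mul_le _ _
        _ ≤ ‖R‖ ^ n * ‖x‖ * ‖star (ψ.toMap p y)‖ := by
          gcongr
          exact (ψ.norm_toMap_le p _).trans (hpow n x)
        _ = _ := by ring
    · rintro c d - - ⟨C, hC, hc⟩ ⟨D, hD, hd⟩
      refine ⟨C + D, by positivity, fun n => ?_⟩
      rw [mul_add, add_mul]
      exact (norm_add_le _ _).trans (add_le_add (hc n) (hd n))
    · rintro t c - ⟨C, hC, hc⟩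
      refine ⟨‖t‖ * C, by positivity, fun n => ?_⟩
      rw [mul_smul_comm, norm_smul, _root_.mul_assoc]
      exact mul_le_mul_of_nonneg_left (hc n) (norm_nonneg t)
  have hle : ‖b * star b‖ ≤ ‖R‖ := by
    refine norm_le_of_norm_pow_mul_le (C := C * ‖star b‖) (IsSelfAdjoint.mul_star_self b)
      (by positivity) (norm_nonneg _) fun n => ?_
    rw [← _root_.mul_assoc]
    calc _ ≤ ‖(b * star b) ^ n * b‖ * ‖star b‖ := norm_mul_le _ _
      _ ≤ C * ‖R‖ ^ n * ‖star b‖ := by gcongr; exact hgrow n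
      _ = _ := by ring
  refine le_of_sq_le_sq ?_ (norm_nonneg _)
  calc ‖b‖ ^ 2 = ‖b * star b‖ := by rw [sq, CStarRing.norm_self_mul_star]
    _ ≤ ‖S * S'‖ := hle
    _ ≤ ‖S‖ * ‖S'‖ := norm_mul_le _ _
    _ ≤ ‖S‖ * ‖S‖ := by gcongr; exact norm_adjoint_le hS
    _ = ‖S‖ ^ 2 := (sq _).symm

theorem exists_mem_mulStarSpan [StarOrderedRing A] {p : P} {S : adjointable A (X p)}
    (hS : S ∈ Submodule.span ℂ {T | ∃ x y : X p, T = theta A x y}) :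
    ∃ b ∈ ψ.mulStarSpan p p,
      ∀ x : X p, b * ψ.toMap p x = ψ.toMap p ((S : X p →L[ℂ] X p) x) := by
  refine Submodule.span_induction (p := fun (S : adjointable A (X p)) _ => ∃ b ∈ ψ.mulStarSpan p p,
    ∀ x : X p, b * ψ.toMap p x = ψ.toMap p ((S : X p →L[ℂ] X p) x)) ?_
    ⟨0, zero_mem _, by simp⟩ ?_ ?_ hS
  · rintro _ ⟨u, v, rfl⟩
    exact ⟨_, ψ.toMap_mul_star_mem p p u v, fun x => ψ.toMap_mul_star_mul p u v x⟩
  · rintro S T - - ⟨b, hb, hb'⟩ ⟨c, hc, hc'⟩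
    exact ⟨b + c, add_mem hb hc, fun x => by simp [add_mul, hb', hc']⟩
  · rintro t S - ⟨b, hb, hb'⟩
    exact ⟨t • b, Submodule.smul_mem _ t hb, fun x => by simp [hb']⟩

/-- The value at `S ∈ 𝓚(X p)` of the continuous extension of `θ_{x,y} ↦ ψ_p(x) ψ_p(y)^*`. -/
theorem exists_mem_closure_mulStarSpan [StarOrderedRing A] {p : P} {S : adjointable A (X p)}
    (hS : S ∈ compacts A (X p)) :
    ∃ b ∈ (ψ.mulStarSpan p p).topologicalClosure,
      ∀ x : X p, b * ψ.toMap p x = ψ.toMap p ((S : X p →L[ℂ] X p) x) := by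
  obtain ⟨T, hT, hlim⟩ := mem_closure_iff_seq_limit.1 hS
  choose b hb hbT using fun n => ψ.exists_mem_mulStarSpan (hT n)
  have hcauchy : CauchySeq b := by
    rw [Metric.cauchySeq_iff']
    intro ε hε
    obtain ⟨N, hN⟩ := Metric.cauchySeq_iff'.1 hlim.cauchySeq ε hε
    refine ⟨N, fun n hn => lt_of_le_of_lt ?_ (hN n hn)⟩
    rw [dist_eq_norm, dist_eq_norm]
    exact ψ.norm_le_of_mul_toMap_eq (sub_mem (hb n) (hb N)) (T n - T N).2
      fun x => by simp [sub_mul, hbT]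
  obtain ⟨c, hc⟩ := cauchySeq_tendsto_of_complete hcauchy
  refine ⟨c, mem_closure_of_tendsto hc (Filter.Eventually.of_forall hb), fun x => ?_⟩
  refine tendsto_nhds_unique (hc.mul_const (ψ.toMap p x)) ?_
  simp only [hbT]
  exact ((ψ.continuous_toMap p).tendsto _).comp
    (((ContinuousLinearMap.apply ℂ (X p) x).continuous.tendsto _).comp
      ((continuous_subtype_val.tendsto S).comp hlim))

variable {ψ} in
/-- For a faithful representation, the operators implemented by the closed span of the
`ψ_p(x) ψ_p(y)^*` are compact, since `ψ_p` is isometric. -/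
theorem Faithful.mem_compacts [StarOrderedRing A] (hψ : ψ.Faithful) {p : P}
    {S : adjointable A (X p)} {b : B} (hb : b ∈ (ψ.mulStarSpan p p).topologicalClosure)
    (h : ∀ x : X p, b * ψ.toMap p x = ψ.toMap p ((S : X p →L[ℂ] X p) x)) :
    S ∈ compacts A (X p) := by
  change S ∈ closure (Submodule.span ℂ {T | ∃ x y : X p, T = theta A x y} :
    Set (adjointable A (X p)))
  rw [Metric.mem_closure_iff]
  intro ε hε
  obtain ⟨c, hc, hbc⟩ := Metric.mem_closure_iff.1 hb ε hε
  obtain ⟨T, hT, hcT⟩ : ∃ T ∈ Submodule.span ℂ {T | ∃ x y : X p, T = theta A x y},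
      ∀ x : X p, c * ψ.toMap p x = ψ.toMap p ((T : X p →L[ℂ] X p) x) := by
    refine Submodule.span_induction (p := fun c _ =>
      ∃ T ∈ Submodule.span ℂ {T | ∃ x y : X p, T = theta A x y},
        ∀ x : X p, c * ψ.toMap p x = ψ.toMap p ((T : X p →L[ℂ] X p) x)) ?_
      ⟨0, zero_mem _, by simp⟩ ?_ ?_ hc
    · rintro _ ⟨u, v, rfl⟩
      exact ⟨theta A u v, Submodule.subset_span ⟨u, v, rfl⟩, ψ.toMap_mul_star_mul p u v⟩
    · rintro c d - - ⟨S, hS, hS'⟩ ⟨T, hT, hT'⟩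
      exact ⟨S + T, add_mem hS hT, fun x => by simp [add_mul, hS', hT']⟩
    · rintro t c - ⟨S, hS, hS'⟩
      exact ⟨t • S, Submodule.smul_mem _ t hS, fun x => by simp [hS']⟩
  refine ⟨T, hT, lt_of_le_of_lt ?_ hbc⟩
  rw [dist_eq_norm, dist_eq_norm]
  refine ContinuousLinearMap.opNorm_le_bound _ (norm_nonneg _) fun x => ?_
  have e : ψ.toMap p (((S - T : adjointable A (X p)) : X p →L[ℂ] X p) x) =
      (b - c) * ψ.toMap p x := by
    simp [sub_mul, h, hcT]
  rw [← hψ.norm_toMap p x, ← hψ.norm_toMap]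
  exact (congrArg norm e).trans_le (norm_mul_le _ _)

end unital

/-! ### Range projections on a Hilbert space -/

section hilbert

variable {H : Type uH} [NormedAddCommGroup H] [InnerProductSpace ℂ H] [CompleteSpace H]
  (ψ : Φ.Representation (H →L[ℂ] H))

theorem toMap_apply_mem_rangeSpace (p : P) (x : X p) (ξ : H) :
    ψ.toMap p x ξ ∈ ψ.rangeSpace p :=
  Submodule.le_topologicalClosure _ (Submodule.subset_span ⟨x, ξ, rfl⟩)

theorem rangeProj_eq_self {p : P} {v : H} (hv : v ∈ ψ.rangeSpace p) : ψ.rangeProj p v = v :=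
  haveI : CompleteSpace (ψ.rangeSpace p) :=
    (Submodule.isClosed_topologicalClosure _).completeSpace_coe
  Submodule.starProjection_eq_self_iff.2 hv

theorem rangeProj_apply_mem (p : P) (v : H) : ψ.rangeProj p v ∈ ψ.rangeSpace p :=
  haveI : CompleteSpace (ψ.rangeSpace p) :=
    (Submodule.isClosed_topologicalClosure _).completeSpace_coe
  Submodule.starProjection_apply_mem _ v

theorem star_rangeProj (p : P) : star (ψ.rangeProj p) = ψ.rangeProj p :=
  haveI : CompleteSpace (ψ.rangeSpace p) :=
    (Submodule.isClosed_topologicalClosure _).completeSpace_coe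
  isSelfAdjoint_starProjection _

theorem rangeProj_mul_toMap (p : P) (x : X p) : ψ.rangeProj p * ψ.toMap p x = ψ.toMap p x :=
  ContinuousLinearMap.ext fun ξ => ψ.rangeProj_eq_self (ψ.toMap_apply_mem_rangeSpace p x ξ)

theorem star_toMap_mul_rangeProj (p : P) (x : X p) :
    star (ψ.toMap p x) * ψ.rangeProj p = star (ψ.toMap p x) := by
  rw [← ψ.star_rangeProj, ← star_mul, ψ.rangeProj_mul_toMap]

theorem mul_rangeProj_of_mem_closure {p q : P} {b : H →L[ℂ] H}
    (hb : b ∈ (ψ.mulStarSpan q p).topologicalClosure) : b * ψ.rangeProj p = b := by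
  have hle : ψ.mulStarSpan q p ≤ LinearMap.eqLocus
      (LinearMap.mulRight ℂ (ψ.rangeProj p)) LinearMap.id := by
    refine Submodule.span_le.2 ?_
    rintro _ ⟨x, y, rfl⟩
    change ψ.toMap q x * star (ψ.toMap p y) * ψ.rangeProj p = ψ.toMap q x * star (ψ.toMap p y)
    rw [_root_.mul_assoc, ψ.star_toMap_mul_rangeProj]
  exact Submodule.topologicalClosure_minimal _ hle
    (isClosed_eq (continuous_id.mul continuous_const) continuous_id) hb

theorem mul_rangeProj_congr {p : P} {b c : H →L[ℂ] H}
    (h : ∀ x : X p, b * ψ.toMap p x = c * ψ.toMap p x) :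
    b * ψ.rangeProj p = c * ψ.rangeProj p := by
  have hle : ψ.rangeSpace p ≤ LinearMap.eqLocus (b : H →ₗ[ℂ] H) (c : H →ₗ[ℂ] H) := by
    refine Submodule.topologicalClosure_minimal _ (Submodule.span_le.2 ?_)
      (isClosed_eq b.continuous c.continuous)
    rintro _ ⟨x, ξ, rfl⟩
    exact DFunLike.congr_fun (h x) ξ
  exact ContinuousLinearMap.ext fun v => hle (ψ.rangeProj_apply_mem p v)

theorem rangeProj_mul_mul_rangeProj {p : P} {b : H →L[ℂ] H}
    (h : ∀ x : X p, ∃ z : X p, b * ψ.toMap p x = ψ.toMap p z) :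
    ψ.rangeProj p * b * ψ.rangeProj p = b * ψ.rangeProj p := by
  refine ψ.mul_rangeProj_congr fun x => ?_
  obtain ⟨z, hz⟩ := h x
  rw [_root_.mul_assoc, hz, ψ.rangeProj_mul_toMap]

/-- The range projection of `X (p * q)` commutes with the operators `ψ_p(x) ψ_p(y)^*`, as these
and their adjoints leave `[ψ(X (p * q)) H]` invariant. -/
theorem toMap_mul_star_mul_rangeProj [StarOrderedRing A] {p q r : P} (h : p * q = r) (x y : X p) :
    ψ.toMap p x * star (ψ.toMap p y) * ψ.rangeProj r =
      ψ.rangeProj r * (ψ.toMap p x * star (ψ.toMap p y)) := by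
  have hinv : ∀ x y : X p, ψ.rangeProj r * (ψ.toMap p x * star (ψ.toMap p y)) * ψ.rangeProj r =
      ψ.toMap p x * star (ψ.toMap p y) * ψ.rangeProj r := fun x y =>
    ψ.rangeProj_mul_mul_rangeProj fun z =>
      ⟨_, ψ.mul_toMap_iota h (theta A x y) (ψ.toMap_mul_star_mul p x y) z⟩
  have h1 := congrArg star (hinv y x)
  simp only [star_mul, star_star, ψ.star_rangeProj] at h1
  rw [← hinv x y, _root_.mul_assoc, h1]

end hilbert

end general

/-! ### The span property and compact alignment -/

section lattice

variable {G : Type uG} [CommGroup G] [Lattice G] [IsOrderedMonoid G]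
  {A : Type uA} [NonUnitalCStarAlgebra A] [PartialOrder A]
  {X : Submonoid.oneLE G → Type uX} [∀ p, NormedAddCommGroup (X p)]
  [∀ p, NormedSpace ℂ (X p)] [∀ p, CStarCorrespondence A (X p)] {Φ : ProductSystem A X}

section nonunital

variable {B : Type uB} [NonUnitalCStarAlgebra B] (ψ : Φ.Representation B)

/-- Compression of the `ψ_{p ∨ q}(z) ψ_{p ∨ q}(w)^*` by `ψ_p(x)^*` and `ψ_q(y)`: after writing `z`
and `w` as products, the first factors are absorbed into the coefficient algebra. -/
theorem star_toMap_mul_mul_toMap_mem (p q : Submonoid.oneLE G) (x : X p) (y : X q) {b : B}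
    (hb : b ∈ (ψ.mulStarSpan (join p q) (join p q)).topologicalClosure) :
    star (ψ.toMap p x) * b * ψ.toMap q y ∈
      (ψ.mulStarSpan (gapLeft p q) (gapRight p q)).topologicalClosure := by
  set W := ψ.mulStarSpan (gapLeft p q) (gapRight p q)
  have key : ∀ (c : B) (w : X (gapRight p q)), c = star (ψ.toMap _ w) → ∀ z : X (join p q),
      star (ψ.toMap p x) * ψ.toMap _ z * c ∈ W.topologicalClosure := by
    rintro _ w rfl z
    refine (Φ.denseRange_tmul (mul_gapLeft p q)).induction_on
      (p := fun z => star (ψ.toMap p x) * ψ.toMap _ z * star (ψ.toMap _ w) ∈ W.topologicalClosure)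
      z ?_ fun t => ?_
    · exact W.isClosed_topologicalClosure.preimage
        ((continuous_const.mul (ψ.continuous_toMap _)).mul continuous_const)
    · induction t using TensorProduct.induction_on with
      | zero => simp
      | add s t hs ht =>
        rw [map_add, map_add, mul_add, add_mul]
        exact add_mem hs ht
      | tmul x' z =>
        change star (ψ.toMap p x) * ψ.toMap _ (Φ.mul (mul_gapLeft p q) x' z) * _ ∈ _
        rw [ψ.star_toMap_mul_toMap_mul]
        exact Submodule.le_topologicalClosure _ (ψ.toMap_mul_star_mem _ _ _ _)
  let f : B →L[ℂ] B := (ContinuousLinearMap.mul ℂ B (star (ψ.toMap p x))).comp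
    ((ContinuousLinearMap.mul ℂ B).flip (ψ.toMap q y))
  have hf : ∀ b, f b = star (ψ.toMap p x) * b * ψ.toMap q y := fun b =>
    (_root_.mul_assoc _ _ _).symm
  rw [← hf]
  refine ψ.mem_closure_of_mem_mulStarSpan f (fun z w => ?_) hb
  rw [hf]
  refine (Φ.denseRange_tmul (mul_gapRight p q)).induction_on
    (p := fun w => star (ψ.toMap p x) * (ψ.toMap _ z * star (ψ.toMap _ w)) * ψ.toMap q y ∈
      W.topologicalClosure) w ?_ fun t => ?_
  · exact W.isClosed_topologicalClosure.preimage
      ((continuous_const.mul (continuous_const.mul (ψ.continuous_toMap _).star)).mul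
        continuous_const)
  · induction t using TensorProduct.induction_on with
    | zero => simp
    | add s t hs ht =>
      rw [map_add, map_add, star_add, mul_add, mul_add, add_mul]
      exact add_mem hs ht
    | tmul y' w =>
      change star (ψ.toMap p x) * (ψ.toMap _ z * star (ψ.toMap _ (Φ.mul (mul_gapRight p q) y' w))) *
        ψ.toMap q y ∈ _
      rw [← _root_.mul_assoc, _root_.mul_assoc]
      refine key _ (left (ip (A := A) y y') w) ?_ z
      rw [← ψ.star_toMap_mul_toMap_mul (mul_gapRight p q), star_mul, star_star]

/-- The span property follows from its covariant form for rank-one operators, since `X p` is the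
closure of the vectors `θ_{u,v} x`. -/
theorem spanProperty_of_mem_closure [StarOrderedRing A]
    (h : ∀ (p q : Submonoid.oneLE G) (x₁ x₂ : X p) (y₁ y₂ : X q),
      ψ.toMap p x₁ * star (ψ.toMap p x₂) * (ψ.toMap q y₁ * star (ψ.toMap q y₂)) ∈
        (ψ.mulStarSpan (join p q) (join p q)).topologicalClosure) : ψ.SpanProperty := by
  intro p q x y
  change _ ∈ (ψ.mulStarSpan (gapLeft p q) (gapRight p q)).topologicalClosure
  set W := (ψ.mulStarSpan (gapLeft p q) (gapRight p q)).topologicalClosure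
  have hclosed : IsClosed {z : X p × X q | star (ψ.toMap p z.1) * ψ.toMap q z.2 ∈ W} :=
    (Submodule.isClosed_topologicalClosure _).preimage
      (((ψ.continuous_toMap p).comp continuous_fst).star.mul
        ((ψ.continuous_toMap q).comp continuous_snd))
  have hmem : (x, y) ∈ closure ({z | ∃ u v : X p, z = rmul u (ip (A := A) v x)} ×ˢ
      {z | ∃ u v : X q, z = rmul u (ip (A := A) v y)}) := by
    rw [closure_prod_eq]
    exact ⟨mem_closure_theta_apply x, mem_closure_theta_apply y⟩
  refine closure_minimal ?_ hclosed hmem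
  rintro ⟨_, _⟩ ⟨⟨u, v, rfl⟩, ⟨u', v', rfl⟩⟩
  change star (ψ.toMap p (rmul u (ip (A := A) v x))) *
    ψ.toMap q (rmul u' (ip (A := A) v' y)) ∈ W
  have e : star (ψ.toMap p (rmul u (ip (A := A) v x))) * ψ.toMap q (rmul u' (ip (A := A) v' y)) =
      star (ψ.toMap p x) * (ψ.toMap p v * star (ψ.toMap p u) *
        (ψ.toMap q u' * star (ψ.toMap q v'))) * ψ.toMap q y := by
    rw [← ψ.toMap_mul_star_mul, ← ψ.toMap_mul_star_mul]
    simp only [star_mul, star_star, _root_.mul_assoc]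
  rw [e]
  exact ψ.star_toMap_mul_mul_toMap_mem p q x y (h p q v u u' v')

variable {ψ} in
theorem NicaCovariantAbstract.spanProperty [StarOrderedRing A] {hΦ : Φ.CompactlyAligned}
    (hψ : ψ.NicaCovariantAbstract hΦ) : ψ.SpanProperty := by
  obtain ⟨K, hK, hKmul⟩ := hψ
  -- `K r` maps `𝓚(X r)` into the closed span, as it is continuous
  have hmem : ∀ (r : Submonoid.oneLE G) (S : compacts A (X r)),
      K r S ∈ (ψ.mulStarSpan r r).topologicalClosure := by
    rintro r ⟨S, hS⟩
    have hle : Submodule.span ℂ {T | ∃ x y : X r, T = theta A x y} ≤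
        Submodule.map (compacts A (X r)).subtype
          ((ψ.mulStarSpan r r).comap (K r : compacts A (X r) →ₗ[ℂ] B)) := by
      refine Submodule.span_le.2 ?_
      rintro _ ⟨x, y, rfl⟩
      refine ⟨⟨theta A x y, theta_mem_compacts A x y⟩, ?_, rfl⟩
      change K r _ ∈ ψ.mulStarSpan r r
      rw [hK]
      exact ψ.toMap_mul_star_mem r r x y
    obtain ⟨T, hT, hlim⟩ := mem_closure_iff_seq_limit.1 hS
    choose T' hT' hTT' using fun n => hle (hT n)
    refine mem_closure_of_tendsto (f := fun n => K r (T' n)) (b := Filter.atTop) ?_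
      (Filter.Eventually.of_forall hT')
    refine ((K r).continuous.tendsto _).comp (tendsto_subtype_rng.2 ?_)
    have : (fun n => (T' n : adjointable A (X r))) = T := funext hTT'
    rwa [this]
  refine ψ.spanProperty_of_mem_closure fun p q x₁ x₂ y₁ y₂ => ?_
  rw [← hK, ← hK, hKmul]
  exact hmem _ _

end nonunital

section hilbert

variable {H : Type uH} [NormedAddCommGroup H] [InnerProductSpace ℂ H] [CompleteSpace H]
  {ψ : Φ.Representation (H →L[ℂ] H)}

theorem NicaCovariant.spanProperty [StarOrderedRing A] (hΦ : Φ.CompactlyAligned)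
    (hψ : ψ.NicaCovariant) :
    ψ.SpanProperty := by
  refine ψ.spanProperty_of_mem_closure fun p q x₁ x₂ y₁ y₂ => ?_
  set r := join p q
  have hS : ∀ z : X r, ψ.toMap p x₁ * star (ψ.toMap p x₂) * ψ.toMap r z = _ :=
    ψ.mul_toMap_iota (mul_gapLeft p q) (theta A x₁ x₂) (ψ.toMap_mul_star_mul p x₁ x₂)
  have hT : ∀ z : X r, ψ.toMap q y₁ * star (ψ.toMap q y₂) * ψ.toMap r z = _ :=
    ψ.mul_toMap_iota (mul_gapRight p q) (theta A y₁ y₂) (ψ.toMap_mul_star_mul q y₁ y₂)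
  obtain ⟨b, hb, hbR⟩ := ψ.exists_mem_closure_mulStarSpan
    (hΦ p q _ (theta_mem_compacts A x₁ x₂) _ (theta_mem_compacts A y₁ y₂))
  -- `b` and the product both implement `(S ⊗ I)(T ⊗ I)` and both vanish off `[ψ_r(X r) H]`
  have h1 : b * ψ.rangeProj r = ψ.toMap p x₁ * star (ψ.toMap p x₂) *
      (ψ.toMap q y₁ * star (ψ.toMap q y₂)) * ψ.rangeProj r := by
    refine ψ.mul_rangeProj_congr fun z => ?_
    rw [_root_.mul_assoc _ _ (ψ.toMap r z), hT, hS]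
    exact hbR z
  have h2 : ψ.toMap p x₁ * star (ψ.toMap p x₂) * (ψ.toMap q y₁ * star (ψ.toMap q y₂)) *
      ψ.rangeProj r =
        ψ.toMap p x₁ * star (ψ.toMap p x₂) * (ψ.toMap q y₁ * star (ψ.toMap q y₂)) := by
    rw [_root_.mul_assoc _ _ (ψ.rangeProj r),
      ψ.toMap_mul_star_mul_rangeProj (mul_gapRight p q) y₁ y₂, ← hψ p q]
    calc _ = ψ.toMap p x₁ * (star (ψ.toMap p x₂) * ψ.rangeProj p) *
          ((ψ.rangeProj q * ψ.toMap q y₁) * star (ψ.toMap q y₂)) := by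
          simp only [_root_.mul_assoc]
      _ = _ := by rw [ψ.star_toMap_mul_rangeProj, ψ.rangeProj_mul_toMap]
  rw [← h2, ← h1, ψ.mul_rangeProj_of_mem_closure hb]
  exact hb

end hilbert

section unital

variable {B : Type uB} [CStarAlgebra B] {ψ : Φ.Representation B}

/-- The span property moves `ψ_p(x₂)^* ψ_q(y₁)` in `ψ_p(x₁) ψ_p(x₂)^* ψ_q(y₁) ψ_q(y₂)^*` into the
closed span of the `ψ(z) ψ(w)^*`; then `x₁ z` and `y₂ w` lie in `X (p ∨ q)`. -/
theorem SpanProperty.mul_mem (h : ψ.SpanProperty) {p q : Submonoid.oneLE G} {b c : B}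
    (hb : b ∈ (ψ.mulStarSpan p p).topologicalClosure)
    (hc : c ∈ (ψ.mulStarSpan q q).topologicalClosure) :
    b * c ∈ (ψ.mulStarSpan (join p q) (join p q)).topologicalClosure := by
  refine ψ.mem_closure_of_mem_mulStarSpan ((ContinuousLinearMap.mul ℂ B).flip c)
    (fun x₁ x₂ => ?_) hb
  refine ψ.mem_closure_of_mem_mulStarSpan
    (ContinuousLinearMap.mul ℂ B (ψ.toMap p x₁ * star (ψ.toMap p x₂))) (fun y₁ y₂ => ?_) hc
  let f : B →L[ℂ] B := (ContinuousLinearMap.mul ℂ B (ψ.toMap p x₁)).comp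
    ((ContinuousLinearMap.mul ℂ B).flip (star (ψ.toMap q y₂)))
  have e : ContinuousLinearMap.mul ℂ B (ψ.toMap p x₁ * star (ψ.toMap p x₂))
      (ψ.toMap q y₁ * star (ψ.toMap q y₂)) = f (star (ψ.toMap p x₂) * ψ.toMap q y₁) := by
    simp [f, _root_.mul_assoc]
  rw [e]
  refine ψ.mem_closure_of_mem_mulStarSpan f (fun z w => ?_) (h p q x₂ y₁)
  have e' : f (ψ.toMap _ z * star (ψ.toMap _ w)) =
      ψ.toMap _ (Φ.mul (mul_gapLeft p q) x₁ z) *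
        star (ψ.toMap _ (Φ.mul (mul_gapRight p q) y₂ w)) := by
    rw [← ψ.toMap_mul, ← ψ.toMap_mul, star_mul]
    simp [f, _root_.mul_assoc]
  rw [e']
  exact Submodule.le_topologicalClosure _ (ψ.toMap_mul_star_mem _ _ _ _)

theorem SpanProperty.compactlyAligned [StarOrderedRing A] (h : ψ.SpanProperty)
    (hψ : ψ.Faithful) : Φ.CompactlyAligned := by
  intro p q S hS T hT
  obtain ⟨b, hb, hbS⟩ := ψ.exists_mem_closure_mulStarSpan hS
  obtain ⟨c, hc, hcT⟩ := ψ.exists_mem_closure_mulStarSpan hT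
  refine hψ.mem_compacts (h.mul_mem hb hc) fun z => ?_
  rw [_root_.mul_assoc, ψ.mul_toMap_iota (mul_gapRight p q) T hcT,
    ψ.mul_toMap_iota (mul_gapLeft p q) S hbS]
  rfl

end unital

end lattice

end ProductSystem.Representation

end

theorem propositionp
    {G : Type uG} [CommGroup G] [Lattice G] [IsOrderedMonoid G]
    {A : Type uA} [NonUnitalCStarAlgebra A] [PartialOrder A] [StarOrderedRing A]
    {X : Submonoid.oneLE G → Type uX} [∀ p, NormedAddCommGroup (X p)]
    [∀ p, NormedSpace ℂ (X p)] [∀ p, CStarCorrespondence A (X p)] (Φ : ProductSystem A X) :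
    (∀ (H : Type uH) [NormedAddCommGroup H] [InnerProductSpace ℂ H] [CompleteSpace H]
      (ψ : Φ.Representation (H →L[ℂ] H)),
      ψ.Faithful → ψ.NicaCovariant → ψ.SpanProperty → Φ.CompactlyAligned) ∧
    (∀ hΦ : Φ.CompactlyAligned,
      (∀ (H : Type uH) [NormedAddCommGroup H] [InnerProductSpace ℂ H] [CompleteSpace H]
        (ψ : Φ.Representation (H →L[ℂ] H)), ψ.NicaCovariant → ψ.SpanProperty) ∧
      (∀ (B : Type uB) [NonUnitalCStarAlgebra B] (ψ : Φ.Representation B),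
        ψ.NicaCovariantAbstract hΦ → ψ.SpanProperty)) :=
  ⟨fun _ _ _ _ _ hψ _ h => h.compactlyAligned hψ,
    fun hΦ => ⟨fun _ _ _ _ _ hψ => hψ.spanProperty hΦ, fun _ _ _ hψ => hψ.spanProperty⟩⟩
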